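/- Let $$P=\begin{pmatrix}3&3&5&4\\1&2&3&3\\1&1&2&1\\2&3&5&5\end{pmatrix},\qquad Q=\begin{pmatrix}1&0&0&0\\0&1&1&0\\0&0&1&1\\0&1&0&0\end{pmatrix},$$ let $\eta$ be the Perron–Frobenius eigenvalue of $P$ (the real eigenvalue that bounds the modulus of every complex eigenvalue), and let $\nu$ be the associated probability eigenvector with positive entries; the pair $(\eta,\nu)$ exists and is unique. Put $\lambda=(\lambda_1,\lambda_2,\lambda_3,\lambda_4)=Q\nu$ and $|\lambda|=\lambda_1+\lambda_2+\lambda_3+\lambda_4$, and define $T$ on $[0,|\lambda|]$ by $$T(x)=\begin{cases}-x+\lambda_1+\lambda_3 & \text{if } x\in[0,\lambda_1),\\ -x+\lambda_1+|\lambda| & \text{if } x\in[\lambda_1,\lambda_1+\lambda_2),\\ -x+\lambda_1+\lambda_2+\lambda_3 & \text{if } x\in[\lambda_1+\lambda_2,\lambda_1+\lambda_2+\lambda_3),\\ -x+\lambda_1+\lambda_3+|\lambda| & \text{if } x\in[\lambda_1+\lambda_2+\lambda_3,|\lambda|].\end{cases}$$ Then $T$ maps $[0,|\lambda|]$ to itself,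 and this 4-interval exchange transformation with flips is minimal and uniquely ergodic: for every $x\in[0,|\lambda|]$ the orbit $\{x,T(x),T^2(x),\dots\}$ is dense in $[0,|\lambda|]$, and normalized Lebesgue measure on $[0,|\lambda|]$ is the one and only $T$-invariant Borel probability measure on $[0,|\lambda|]$. -/

import Mathlib

open MeasureTheory Set
open scoped Matrix

namespace FlipIET

/-- The integer matrix `P`. -/
def P : Matrix (Fin 4) (Fin 4) ℤ :=
  !![3, 3, 5, 4;
     1, 2, 3, 3;
     1, 1, 2, 1;
     2, 3, 5, 5]

/-- The integer matrix `Q`. -/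
def Q : Matrix (Fin 4) (Fin 4) ℤ :=
  !![1, 0, 0, 0;
     0, 1, 1, 0;
     0, 0, 1, 1;
     0, 1, 0, 0]

/-- `η` is the Perron-Frobenius eigenvalue of the square matrix `A`: it is an eigenvalue of `A`,
and it bounds the modulus of every complex eigenvalue of `A`. -/
def IsPerronFrobeniusEigenvalue (A : Matrix (Fin 4) (Fin 4) ℤ) (η : ℝ) : Prop :=
  Module.End.HasEigenvalue (Matrix.toLin' (A.map (fun a : ℤ => (a : ℂ)))) (η : ℂ) ∧
    ∀ z : ℂ, Module.End.HasEigenvalue (Matrix.toLin' (A.map (fun a : ℤ => (a : ℂ)))) z → ‖z‖ ≤ η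

/-- `η` is the Perron-Frobenius eigenvalue of `A`, and `ν` is a probability eigenvector of `A` with
positive entries associated with `η`. -/
structure IsPerronFrobeniusPair (A : Matrix (Fin 4) (Fin 4) ℤ) (η : ℝ) (ν : Fin 4 → ℝ) :
    Prop where
  eigenvalue : IsPerronFrobeniusEigenvalue A η
  eigenvector : A.map (fun a : ℤ => (a : ℝ)) *ᵥ ν = η • ν
  pos : ∀ i, 0 < ν i
  sum_eq_one : ∑ i, ν i = 1

/-- The length vector `Q ν`. -/
def lengths (ν : Fin 4 → ℝ) : Fin 4 → ℝ :=
  Q.map (fun a : ℤ => (a : ℝ)) *ᵥ ν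

/-- The norm `|l| = l₁ + l₂ + l₃ + l₄` of a length vector. -/
def total (l : Fin 4 → ℝ) : ℝ := l 0 + l 1 + l 2 + l 3

/-- The interval `[0, |l|]`. -/
def domain (l : Fin 4 → ℝ) : Set ℝ := Icc 0 (total l)

/-- The 4-interval exchange transformation with flips with length vector `l`. It is considered on
`domain l` only, which it maps to itself when the entries of `l` are positive. -/
noncomputable def T (l : Fin 4 → ℝ) (x : ℝ) : ℝ :=
  if x < l 0 then -x + l 0 + l 2
  else if x < l 0 + l 1 then -x + l 0 + total l
  else if x < l 0 + l 1 + l 2 then -x + l 0 + l 1 + l 2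
  else -x + l 0 + l 2 + total l

/-- The orbit `{x, f x, f (f x), …}`. -/
def orbit (f : ℝ → ℝ) (x : ℝ) : Set ℝ := {y | ∃ k : ℕ, y = f^[k] x}

/-- `f` is a minimal self-map of `s`: every orbit of a point of `s` is dense in `s`. -/
def IsMinimalOn (f : ℝ → ℝ) (s : Set ℝ) : Prop :=
  ∀ x ∈ s, s ⊆ closure (orbit f x)

/-- Normalized Lebesgue measure on `s`. -/
noncomputable def normalizedLebesgue (s : Set ℝ) : Measure ℝ :=
  (volume s)⁻¹ • volume.restrict s

/-- `f` is a uniquely ergodic self-map of `s`: among the Borel measures on `s` (that is, on the real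
line and carried by `s`), normalized Lebesgue measure is an `f`-invariant probability measure, and
it is the only one. -/
def IsUniquelyErgodicOn (f : ℝ → ℝ) (s : Set ℝ) : Prop :=
  ∀ μ : Measure ℝ,
    (IsProbabilityMeasure μ ∧ μ sᶜ = 0 ∧ MeasurePreserving f μ μ) ↔ μ = normalizedLebesgue s

end FlipIET

/-! Written in terms of ν, the map is the exchange `exT`, and its return map to [0, |ν|] is an
exchange `exS` that reproduces itself: with lengths Pv it induces on [0, |v|] the same exchange with
lengths v. Since Pν = ην, this renormalization repeats at all scales η⁻ⁿν. All endpoints are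
integral linear forms compared coefficientwise, so the two inductions (`induces_exT`, `induces_exS`)
are finite checks, valid for every positive v.

Minimality: every point reaches the inducing interval of every scale, every return word of `exS`
uses all four branches, and the towers over the small intervals fill the domain. So an orbit that
avoids the endpoints is dense (`dense_orbit`). An orbit that meets an endpoint soon lands on one of
finitely many points that never meet one again, because each of them (or an iterate of it) travels
inside the open intervals to its own copy at the next scale (`openRun_singular`).

Unique ergodicity: minimality excludes atoms, so the distribution function of an invariant measure
is equivariant under the closed branches. Its increments over the intervals of `exS` at successive
scales form a nonnegative backward orbit of P, and positivity of P makes them proportional to the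
lengths (`constant_of_stochastic`). After subtraction of a linear function, what is left vanishes at
the endpoints, so its absolute value is constant along orbits; it is arbitrarily small on the small
intervals, which every orbit meets. Hence it is zero (`linear_of_equivariant`). -/

namespace FlipIET
-- Integral linear forms in the lengths
/-- The value at `v` of the integral linear form with coefficients `z`. -/
def ev (z : Fin 4 → ℤ) (v : Fin 4 → ℝ) : ℝ :=
  z 0 * v 0 + z 1 * v 1 + z 2 * v 2 + z 3 * v 3

/-- Coefficientwise comparison of integral linear forms. -/
abbrev FormLE (z w : Fin 4 → ℤ) : Prop := ∀ k, z k ≤ w k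

/-- This turns inequalities between endpoints, for all positive lengths at once, into decidable
integer comparisons. -/
theorem ev_le {z w : Fin 4 → ℤ} {v : Fin 4 → ℝ} (hv : ∀ k, 0 < v k) (h : FormLE z w) :
    ev z v ≤ ev w v := by
  have key : ∀ k, (z k : ℝ) * v k ≤ w k * v k := fun k =>
    mul_le_mul_of_nonneg_right (by exact_mod_cast h k) (hv k).le
  unfold ev
  linarith [key 0, key 1, key 2, key 3]

theorem ev_lt {z w : Fin 4 → ℤ} {v : Fin 4 → ℝ} (hv : ∀ k, 0 < v k) (h : FormLE z w)
    (hne : ∃ k, z k ≠ w k) : ev z v < ev w v := by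
  have key : ∀ k, (z k : ℝ) * v k ≤ w k * v k := fun k =>
    mul_le_mul_of_nonneg_right (by exact_mod_cast h k) (hv k).le
  obtain ⟨k, hk⟩ := hne
  have hlt : (z k : ℝ) * v k < w k * v k :=
    mul_lt_mul_of_pos_right (by exact_mod_cast lt_of_le_of_ne (h k) hk) (hv k)
  unfold ev
  fin_cases k <;> simp at hlt <;> linarith [key 0, key 1, key 2, key 3]

theorem ev_add (z w : Fin 4 → ℤ) (v : Fin 4 → ℝ) : ev (z + w) v = ev z v + ev w v := by
  simp [ev]; ring

theorem ev_sub (z w : Fin 4 → ℤ) (v : Fin 4 → ℝ) : ev (z - w) v = ev z v - ev w v := by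
  simp [ev]; ring

theorem ev_zero (v : Fin 4 → ℝ) : ev 0 v = 0 := by simp [ev]

/-! ### Formal exchanges, words, tilings and inducing -/

/-- A formal exchange of four intervals with flips, whose endpoints and translation parameters are
integral linear forms in a length parameter `v`. -/
structure Exchange where
  left : Fin 4 → Fin 4 → ℤ
  right : Fin 4 → Fin 4 → ℤ
  shift : Fin 4 → Fin 4 → ℤ
  flip : Fin 4 → Bool

namespace Exchange

variable (D E : Exchange) (v : Fin 4 → ℝ)

/-- The `j`-th closed interval. -/
def piece (j : Fin 4) : Set ℝ := Icc (ev (D.left j) v) (ev (D.right j) v)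

/-- The whole interval. -/
def whole : Set ℝ := Icc (ev (D.left 0) v) (ev (D.right 3) v)

/-- The `j`-th affine branch. -/
noncomputable def branch (j : Fin 4) (x : ℝ) : ℝ :=
  if D.flip j then ev (D.shift j) v - x else x + ev (D.shift j) v

/-- The `j`-th branch on linear forms. -/
def formBranch (j : Fin 4) (z : Fin 4 → ℤ) : Fin 4 → ℤ :=
  if D.flip j then D.shift j - z else z + D.shift j

theorem ev_formBranch (j : Fin 4) (z : Fin 4 → ℤ) :
    ev (D.formBranch j z) v = D.branch v j (ev z v) := by
  unfold formBranch branch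
  split_ifs <;> simp [ev_add, ev_sub]

/-- The image of a formal interval under the `j`-th branch. -/
def image (j : Fin 4) (I : (Fin 4 → ℤ) × (Fin 4 → ℤ)) : (Fin 4 → ℤ) × (Fin 4 → ℤ) :=
  if D.flip j then (D.shift j - I.2, D.shift j - I.1) else (I.1 + D.shift j, I.2 + D.shift j)

/-- The closed interval of reals given by a formal interval. -/
def real (I : (Fin 4 → ℤ) × (Fin 4 → ℤ)) : Set ℝ := Icc (ev I.1 v) (ev I.2 v)

/-- The open interval of reals given by a formal interval. -/
def openReal (I : (Fin 4 → ℤ) × (Fin 4 → ℤ)) : Set ℝ := Ioo (ev I.1 v) (ev I.2 v)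

theorem branch_mem_real {j : Fin 4} {I : (Fin 4 → ℤ) × (Fin 4 → ℤ)} {x : ℝ} :
    D.branch v j x ∈ real v (D.image j I) ↔ x ∈ real v I := by
  unfold branch image real
  split_ifs <;> simp only [ev_add, ev_sub, mem_Icc] <;> constructor <;> rintro ⟨h1, h2⟩ <;>
    constructor <;> linarith

theorem branch_mem_openReal {j : Fin 4} {I : (Fin 4 → ℤ) × (Fin 4 → ℤ)} {x : ℝ} :
    D.branch v j x ∈ openReal v (D.image j I) ↔ x ∈ openReal v I := by
  unfold branch image openReal
  split_ifs <;> simp only [ev_add, ev_sub, mem_Ioo] <;> constructor <;> rintro ⟨h1, h2⟩ <;>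
    constructor <;> linarith

theorem branch_surjective (j : Fin 4) : Function.Surjective (D.branch v j) := by
  intro y
  unfold branch
  split_ifs
  · exact ⟨ev (D.shift j) v - y, by ring⟩
  · exact ⟨y - ev (D.shift j) v, by ring⟩

theorem abs_branch_sub (j : Fin 4) (x y : ℝ) :
    |D.branch v j x - D.branch v j y| = |x - y| := by
  unfold branch
  split_ifs
  · rw [abs_sub_comm x y]; congr 1; ring
  · congr 1; ring

/-- The multivalued map whose graph is the union of the graphs of the branches on closed
intervals. -/
def Step (x y : ℝ) : Prop := ∃ j, x ∈ D.piece v j ∧ y = D.branch v j x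

/-- The restriction of the exchange to the open intervals. -/
def OpenStep (x y : ℝ) : Prop :=
  ∃ j, x ∈ Ioo (ev (D.left j) v) (ev (D.right j) v) ∧ y = D.branch v j x

/-- The composition of the branches along a word. -/
noncomputable def along (w : List (Fin 4)) (x : ℝ) : ℝ := w.foldl (fun x j => D.branch v j x) x

@[simp] theorem along_nil (x : ℝ) : D.along v [] x = x := rfl

@[simp] theorem along_cons (j : Fin 4) (w : List (Fin 4)) (x : ℝ) :
    D.along v (j :: w) x = D.along v w (D.branch v j x) := rfl

theorem along_append (w₁ w₂ : List (Fin 4)) (x : ℝ) :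
    D.along v (w₁ ++ w₂) x = D.along v w₂ (D.along v w₁ x) := by
  simp [along, List.foldl_append]

theorem abs_along_sub (w : List (Fin 4)) (x y : ℝ) :
    |D.along v w x - D.along v w y| = |x - y| := by
  induction w generalizing x y with
  | nil => rfl
  | cons j w ih => simp [ih, abs_branch_sub]

/-- The formal interval reached from `I` along a word. -/
def level (w : List (Fin 4)) (I : (Fin 4 → ℤ) × (Fin 4 → ℤ)) : (Fin 4 → ℤ) × (Fin 4 → ℤ) :=
  w.foldl (fun I j => D.image j I) I

@[simp] theorem level_nil (I : (Fin 4 → ℤ) × (Fin 4 → ℤ)) : D.level [] I = I := rfl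

@[simp] theorem level_cons (j : Fin 4) (w : List (Fin 4)) (I : (Fin 4 → ℤ) × (Fin 4 → ℤ)) :
    D.level (j :: w) I = D.level w (D.image j I) := rfl

/-- The formal interval `I` is carried along the word `w` inside the intervals of the exchange. -/
def Admissible : List (Fin 4) → (Fin 4 → ℤ) × (Fin 4 → ℤ) → Prop
  | [], _ => True
  | j :: w, I => FormLE (D.left j) I.1 ∧ FormLE I.2 (D.right j) ∧ Admissible w (D.image j I)

instance decidableAdmissible : ∀ w I, Decidable (D.Admissible w I)
  | [], _ => inferInstanceAs (Decidable True)
  | j :: w, I =>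
    have := decidableAdmissible w (D.image j I)
    inferInstanceAs (Decidable (_ ∧ _ ∧ _))

theorem admissible_append {w₁ w₂ : List (Fin 4)} {I : (Fin 4 → ℤ) × (Fin 4 → ℤ)} :
    D.Admissible (w₁ ++ w₂) I ↔ D.Admissible w₁ I ∧ D.Admissible w₂ (D.level w₁ I) := by
  induction w₁ generalizing I with
  | nil => simp [Admissible]
  | cons j w ih => simp [Admissible, ih, and_assoc]

/-- The linear part (`true` for a reversal) and the translation part of `D.along v w`. -/
def total : List (Fin 4) → Bool × (Fin 4 → ℤ)
  | [] => (false, 0)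
  | j :: w => (xor (total w).1 (D.flip j),
      if (total w).1 then (total w).2 - D.shift j else (total w).2 + D.shift j)

theorem along_eq (w : List (Fin 4)) (x : ℝ) :
    D.along v w x = if (D.total w).1 then ev (D.total w).2 v - x else x + ev (D.total w).2 v := by
  induction w generalizing x with
  | nil => simp [total, ev_zero]
  | cons j w ih =>
    rw [along_cons, ih]
    rcases h : D.total w with ⟨s, c⟩
    rcases hf : D.flip j <;> cases s <;> simp [total, branch, h, hf, ev_add, ev_sub] <;> ring

variable {D E v}

theorem mem_piece_of_formLE (hv : ∀ k, 0 < v k) {j : Fin 4} {I : (Fin 4 → ℤ) × (Fin 4 → ℤ)}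
    (h₁ : FormLE (D.left j) I.1) (h₂ : FormLE I.2 (D.right j)) {x : ℝ} (hx : x ∈ real v I) :
    x ∈ D.piece v j :=
  ⟨(ev_le hv h₁).trans hx.1, hx.2.trans (ev_le hv h₂)⟩

theorem along_mem_real {w : List (Fin 4)}
    {I : (Fin 4 → ℤ) × (Fin 4 → ℤ)} {x : ℝ} (hx : x ∈ real v I) :
    D.along v w x ∈ real v (D.level w I) := by
  induction w generalizing I x with
  | nil => exact hx
  | cons j w ih => exact ih ((D.branch_mem_real v).2 hx)

theorem exists_along_eq {w : List (Fin 4)} {I : (Fin 4 → ℤ) × (Fin 4 → ℤ)} {y : ℝ}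
    (hy : y ∈ real v (D.level w I)) : ∃ x ∈ real v I, D.along v w x = y := by
  induction w generalizing I with
  | nil => exact ⟨y, hy, rfl⟩
  | cons j w ih =>
    obtain ⟨x, hx, rfl⟩ := ih hy
    obtain ⟨z, rfl⟩ := D.branch_surjective v j x
    exact ⟨z, (D.branch_mem_real v).1 hx, rfl⟩

theorem Admissible.reflTransGen (hv : ∀ k, 0 < v k) {w : List (Fin 4)}
    {I : (Fin 4 → ℤ) × (Fin 4 → ℤ)} (h : D.Admissible w I) {x : ℝ} (hx : x ∈ real v I) :
    Relation.ReflTransGen (D.Step v) x (D.along v w x) := by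
  induction w generalizing I x with
  | nil => exact .refl
  | cons j w ih =>
    exact .head ⟨j, mem_piece_of_formLE hv h.1 h.2.1 hx, rfl⟩
      (ih h.2.2 ((D.branch_mem_real v).2 hx))

/-- `D.OpenRun v n x`: the point `x` has an orbit of length `n` in the open intervals. -/
def OpenRun (D : Exchange) (v : Fin 4 → ℝ) : ℕ → ℝ → Prop
  | 0, _ => True
  | n + 1, x => ∃ y, D.OpenStep v x y ∧ OpenRun D v n y

theorem OpenRun.mono {m n : ℕ} (hmn : m ≤ n) {x : ℝ} (h : D.OpenRun v n x) :
    D.OpenRun v m x := by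
  induction m generalizing n x with
  | zero => trivial
  | succ m ih =>
    obtain ⟨n, rfl⟩ : ∃ k, n = k + 1 := ⟨n - 1, by omega⟩
    obtain ⟨y, hy, hr⟩ := h
    exact ⟨y, hy, ih (by omega) hr⟩

theorem Admissible.openRun (hv : ∀ k, 0 < v k) {w : List (Fin 4)}
    {I : (Fin 4 → ℤ) × (Fin 4 → ℤ)} (h : D.Admissible w I) {x : ℝ} (hx : x ∈ openReal v I)
    {n : ℕ} (hn : D.OpenRun v n (D.along v w x)) : D.OpenRun v (n + w.length) x := by
  induction w generalizing I x with
  | nil => exact hn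
  | cons j w ih =>
    exact ⟨_, ⟨j, ⟨(ev_le hv h.1).trans_lt hx.1, hx.2.trans_le (ev_le hv h.2.1)⟩, rfl⟩,
      ih h.2.2 ((D.branch_mem_openReal v).2 hx) hn⟩

/-- The formal point `z` is carried along `w` to the formal point `z'`, inside the open
intervals. -/
def PointPath (D : Exchange) (z' : Fin 4 → ℤ) : List (Fin 4) → (Fin 4 → ℤ) → Prop
  | [], z => z = z'
  | j :: w, z => (FormLE (D.left j) z ∧ ∃ k, D.left j k ≠ z k) ∧
      (FormLE z (D.right j) ∧ ∃ k, z k ≠ D.right j k) ∧ PointPath D z' w (D.formBranch j z)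

instance decidablePointPath (z' : Fin 4 → ℤ) : ∀ w z, Decidable (D.PointPath z' w z)
  | [], z => inferInstanceAs (Decidable (z = z'))
  | j :: w, z =>
    have := decidablePointPath z' w (D.formBranch j z)
    inferInstanceAs (Decidable ((_ ∧ _) ∧ (_ ∧ _) ∧ _))

theorem PointPath.openRun (hv : ∀ k, 0 < v k) {z' : Fin 4 → ℤ} {w : List (Fin 4)}
    {z : Fin 4 → ℤ} (h : D.PointPath z' w z) {n : ℕ} (hn : D.OpenRun v n (ev z' v)) :
    D.OpenRun v (n + w.length) (ev z v) := by
  induction w generalizing z with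
  | nil => rw [show z = z' from h]; exact hn
  | cons j w ih =>
    refine ⟨_, ⟨j, ⟨ev_lt hv h.1.1 h.1.2, ev_lt hv h.2.1.1 h.2.1.2⟩, rfl⟩, ?_⟩
    rw [← ev_formBranch]
    exact ih h.2.2

/-- The formal intervals of the list `l` are adjacent and run from `a` to `b`. -/
def Tiles (b : Fin 4 → ℤ) : List ((Fin 4 → ℤ) × (Fin 4 → ℤ)) → (Fin 4 → ℤ) → Prop
  | [], a => a = b
  | I :: l, a => I.1 = a ∧ Tiles b l I.2

instance decidableTiles (b : Fin 4 → ℤ) : ∀ l a, Decidable (Tiles b l a)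
  | [], a => inferInstanceAs (Decidable (a = b))
  | I :: l, _ =>
    have := decidableTiles b l I.2
    inferInstanceAs (Decidable (_ ∧ _))

theorem Tiles.exists_mem {b : Fin 4 → ℤ} {l : List ((Fin 4 → ℤ) × (Fin 4 → ℤ))}
    {a : Fin 4 → ℤ} (hl : l ≠ []) (h : Tiles b l a) {x : ℝ} (hx : x ∈ real v (a, b)) :
    ∃ I ∈ l, x ∈ real v I := by
  induction l generalizing a with
  | nil => exact absurd rfl hl
  | cons I l ih =>
    obtain ⟨rfl, h2⟩ := h
    by_cases hxI : x ≤ ev I.2 v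
    · exact ⟨I, by simp, hx.1, hxI⟩
    · rcases l with _ | ⟨J, l⟩
      · rw [show I.2 = b from h2] at hxI
        exact absurd hx.2 hxI
      · obtain ⟨K, hK, hxK⟩ := ih (by simp) h2 ⟨(not_le.1 hxI).le, hx.2⟩
        exact ⟨K, by simp [hK], hxK⟩

theorem Tiles.sum_eq {b : Fin 4 → ℤ} {l : List ((Fin 4 → ℤ) × (Fin 4 → ℤ))}
    {a : Fin 4 → ℤ} (h : Tiles b l a) (F : ℝ → ℝ) :
    F (ev b v) - F (ev a v) = (l.map fun I => F (ev I.2 v) - F (ev I.1 v)).sum := by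
  induction l generalizing a with
  | nil => simp [show a = b from h]
  | cons I l ih =>
    obtain ⟨rfl, h2⟩ := h
    rw [List.map_cons, List.sum_cons, ← ih h2]
    ring

theorem Tiles.eq_zero {b : Fin 4 → ℤ} {l : List ((Fin 4 → ℤ) × (Fin 4 → ℤ))}
    {a : Fin 4 → ℤ} (h : Tiles b l a) {H : ℝ → ℝ} (ha : H (ev a v) = 0)
    (hl : ∀ I ∈ l, H (ev I.2 v) = H (ev I.1 v)) : ∀ I ∈ l, H (ev I.1 v) = 0 := by
  induction l generalizing a with
  | nil => simp
  | cons I l ih =>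
    obtain ⟨rfl, h2⟩ := h
    have hI : H (ev I.2 v) = 0 := (hl I (by simp)).trans ha
    have := ih h2 hI fun J hJ => hl J (by simp [hJ])
    simpa [ha] using this

/-- The formal intervals are adjacent and so are their images, in the given order. -/
structure IsExchange (D : Exchange) (order : List (Fin 4)) : Prop where
  left_zero : D.left 0 = 0
  le : ∀ j, FormLE (D.left j) (D.right j)
  sorted : ∀ i j, i < j → FormLE (D.right i) (D.left j)
  tiles : Tiles (D.right 3) [(D.left 0, D.right 0), (D.left 1, D.right 1), (D.left 2, D.right 2),
    (D.left 3, D.right 3)] 0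
  mem_order : ∀ j, j ∈ order
  image_tiles : Tiles (D.right 3) (order.map fun j => D.image j (D.left j, D.right j)) 0
  image_mem : ∀ j, FormLE 0 (D.image j (D.left j, D.right j)).1 ∧
    FormLE (D.image j (D.left j, D.right j)).2 (D.right 3)

theorem IsExchange.exists_mem_piece {o : List (Fin 4)} (h : D.IsExchange o) {x : ℝ}
    (hx : x ∈ D.whole v) : ∃ j, x ∈ D.piece v j := by
  unfold whole at hx
  rw [h.left_zero] at hx
  obtain ⟨I, hI, hxI⟩ := h.tiles.exists_mem (by simp) hx
  simp only [List.mem_cons, List.not_mem_nil, or_false] at hI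
  rcases hI with rfl | rfl | rfl | rfl
  exacts [⟨0, hxI⟩, ⟨1, hxI⟩, ⟨2, hxI⟩, ⟨3, hxI⟩]

theorem IsExchange.branch_mem {o : List (Fin 4)} (h : D.IsExchange o) (hv : ∀ k, 0 < v k)
    {j : Fin 4} {x : ℝ} (hx : x ∈ D.piece v j) : D.branch v j x ∈ D.whole v := by
  have := (D.branch_mem_real v (j := j) (I := (D.left j, D.right j))).2 hx
  refine ⟨?_, this.2.trans (ev_le hv (h.image_mem j).2)⟩
  rw [h.left_zero]
  exact (ev_le hv (h.image_mem j).1).trans this.1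

/-- `E` is obtained from `D` by inducing: the interval `i` of `E` returns along the word `w i`, and
the interval `j` of `D` is tiled by the levels `tile j` (a pair `(i, k)` stands for the `k`-th
level of the tower over the interval `i`). -/
structure Induces (D E : Exchange) (w : Fin 4 → List (Fin 4))
    (tile : Fin 4 → List (Fin 4 × ℕ)) : Prop where
  ne_nil : ∀ i, w i ≠ []
  admissible : ∀ i, D.Admissible (w i) (E.left i, E.right i)
  total_eq : ∀ i, D.total (w i) = (E.flip i, E.shift i)
  tile_ne_nil : ∀ j, tile j ≠ []
  tiles : ∀ j, Tiles (D.right j)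
    ((tile j).map fun p => D.level ((w p.1).take p.2) (E.left p.1, E.right p.1)) (D.left j)
  level_mem : ∀ j, ∀ p ∈ tile j,
    FormLE (D.left j) (D.level ((w p.1).take p.2) (E.left p.1, E.right p.1)).1 ∧
    FormLE (D.level ((w p.1).take p.2) (E.left p.1, E.right p.1)).2 (D.right j)


end Exchange
end FlipIET

/-! ### The two exchanges and the combinatorial data of their inductions -/

namespace FlipIET

/-- The substitution `v ↦ P v` on linear forms. -/
def pull (z : Fin 4 → ℤ) : Fin 4 → ℤ :=
  fun k => z 0 * P 0 k + z 1 * P 1 k + z 2 * P 2 k + z 3 * P 3 k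

theorem ev_pull (z : Fin 4 → ℤ) (v : Fin 4 → ℝ) :
    ev (pull z) v = ev z (P.map (fun a : ℤ => (a : ℝ)) *ᵥ v) := by
  simp [ev, pull, Matrix.mulVec, dotProduct, Fin.sum_univ_four]
  ring

/-- The exchange obtained from `D` by the substitution `v ↦ P v`. -/
def Exchange.subst (D : Exchange) : Exchange where
  left j := pull (D.left j)
  right j := pull (D.right j)
  shift j := pull (D.shift j)
  flip := D.flip

/-- The exchange `T`, with endpoints written in terms of `ν`. -/
def exT : Exchange where
  left := ![![0, 0, 0, 0], ![1, 0, 0, 0], ![1, 1, 1, 0], ![1, 1, 2, 1]]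
  right := ![![1, 0, 0, 0], ![1, 1, 1, 0], ![1, 1, 2, 1], ![1, 2, 2, 1]]
  shift := ![![1, 0, 1, 1], ![2, 2, 2, 1], ![1, 1, 2, 1], ![2, 2, 3, 2]]
  flip := ![true, true, true, true]

/-- The exchange induced by `T` on `[0, ν₁ + ν₂ + ν₃ + ν₄]`. -/
def exS : Exchange where
  left := ![![0, 0, 0, 0], ![1, 0, 0, 0], ![1, 1, 0, 0], ![1, 1, 1, 0]]
  right := ![![1, 0, 0, 0], ![1, 1, 0, 0], ![1, 1, 1, 0], ![1, 1, 1, 1]]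
  shift := ![![1, 0, 1, 1], ![0, 0, 1, 1], ![-1, -1, 0, 0], ![1, 1, 2, 1]]
  flip := ![true, false, false, true]

theorem isExchange_exT : exT.IsExchange [2, 0, 3, 1] := by
  constructor <;> decide

theorem isExchange_exS : exS.IsExchange [2, 3, 0, 1] := by
  constructor <;> decide

/-- The return words of the exchange induced by `exT`. -/
def wordT : Fin 4 → List (Fin 4) := ![[0], [1, 3], [1, 2], [2]]

/-- The levels over the intervals of `exS`, in the order in which they tile those of `exT`. -/
def tileT : Fin 4 → List (Fin 4 × ℕ) :=
  ![[(0, 0)], [(1, 0), (2, 0)], [(3, 0), (2, 1)], [(1, 1)]]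

/-- The return words of the self-similar exchange `exS`. -/
def wordS : Fin 4 → List (Fin 4) :=
  ![[0, 3, 0, 1, 3, 0, 2],
    [0, 3, 1, 3, 0, 1, 3, 0, 2],
    [0, 3, 1, 3, 0, 1, 3, 0, 2, 0, 3, 1, 3, 0, 2],
    [0, 3, 1, 3, 0, 1, 3, 0, 3, 1, 3, 0, 2]]

/-- The levels over the small intervals of `exS`, in the order in which they tile those of
`exS`. -/
def tileS : Fin 4 → List (Fin 4 × ℕ) :=
  ![[(0, 0), (1, 0), (2, 0), (3, 0), (2, 9), (3, 7), (2, 7), (1, 7), (0, 5), (3, 11), (2, 13),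
      (3, 4), (2, 4), (1, 4), (0, 2)],
    [(1, 2), (2, 2), (3, 2), (2, 11), (3, 9), (0, 3), (1, 5), (2, 5), (3, 5)],
    [(2, 14), (3, 12), (0, 6), (1, 8), (2, 8)],
    [(3, 8), (2, 10), (3, 1), (2, 1), (1, 1), (0, 1), (1, 3), (2, 3), (3, 3), (2, 12), (3, 10),
      (0, 4), (1, 6), (2, 6), (3, 6)]]

theorem induces_exT : exT.Induces exS wordT tileT := by
  constructor <;> decide

set_option maxRecDepth 10000 in
theorem induces_exS : exS.subst.Induces exS wordS tileS := by
  constructor <;> decide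

theorem mem_wordS (i j : Fin 4) : j ∈ wordS i := by
  revert i j; decide

/-- The incidence matrix of the tiling is P: entry (j, i) counts the levels over interval i inside
interval j. -/
theorem tileS_count (m : Fin 4 → ℝ) (j : Fin 4) :
    ((tileS j).map fun p => m p.1).sum = (P.map (fun a : ℤ => (a : ℝ)) *ᵥ m) j := by
  fin_cases j <;> simp [tileS, P, Matrix.mulVec, dotProduct, Fin.sum_univ_four] <;> ring

/-- The images of the discontinuities of `exS`. -/
def singular : Fin 3 → Fin 4 → ℤ := ![![0, 0, 1, 0], ![0, 0, 1, 1], ![1, 0, 1, 1]]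

/-- Self-similarity of the singular orbits: the copy of the point at the larger scale reaches its
copy at the smaller scale without touching an endpoint. -/
theorem pointPath_singular (c : Fin 3) :
    exS.subst.PointPath (singular c)
      ((![[0, 3, 1, 3, 0, 2], [1, 3, 0, 2], [3, 0, 1, 3, 0, 2]] : Fin 3 → List (Fin 4)) c)
      (pull (singular c)) := by
  revert c; decide

theorem pointPath_exT : exT.PointPath (singular 0) [2] ![1, 1, 1, 1] := by
  decide

end FlipIET

/-! ### Orbits under inducing and change of scale; density -/

namespace FlipIET
namespace Exchange

variable {D E : Exchange} {v : Fin 4 → ℝ} {w : Fin 4 → List (Fin 4)}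
  {tile : Fin 4 → List (Fin 4 × ℕ)}

theorem Induces.branch_eq (h : D.Induces E w tile) (i : Fin 4) (x : ℝ) :
    E.branch v i x = D.along v (w i) x := by
  rw [along_eq, h.total_eq, branch]

theorem Induces.reflTransGen (h : D.Induces E w tile) (hv : ∀ k, 0 < v k) {x y : ℝ}
    (hxy : Relation.ReflTransGen (E.Step v) x y) : Relation.ReflTransGen (D.Step v) x y := by
  induction hxy with
  | refl => exact .refl
  | tail _ hst ih =>
    obtain ⟨i, hi, rfl⟩ := hst
    rw [h.branch_eq]
    exact ih.trans ((h.admissible i).reflTransGen hv hi)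

theorem Induces.openRun (h : D.Induces E w tile) (hv : ∀ k, 0 < v k) {n : ℕ} {x : ℝ}
    (hx : E.OpenRun v n x) : D.OpenRun v n x := by
  induction n generalizing x with
  | zero => trivial
  | succ n ih =>
    obtain ⟨y, ⟨i, hi, rfl⟩, hy⟩ := hx
    have := ih hy
    rw [h.branch_eq] at this
    exact ((h.admissible i).openRun hv hi this).mono
      (Nat.add_le_add_left (List.length_pos_iff.2 (h.ne_nil i)) n)

/-- Every point lies on a piece of orbit starting and ending in the inducing interval; the points
of the corresponding interval of `E` follow it isometrically. -/
theorem Induces.exists_tower (h : D.Induces E w tile) (hv : ∀ k, 0 < v k) {o : List (Fin 4)}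
    (hE : E.IsExchange o) {j : Fin 4} {y : ℝ} (hy : y ∈ D.piece v j) :
    (∃ z ∈ E.whole v, Relation.ReflTransGen (D.Step v) y z) ∧
    ∃ i, ∃ g : ℝ → ℝ, (∀ a b, |g a - g b| = |a - b|) ∧ (∃ z ∈ E.piece v i, g z = y) ∧
      ∀ a ∈ E.piece v i, g a ∈ D.piece v j ∧ Relation.ReflTransGen (D.Step v) a (g a) := by
  obtain ⟨I, hI, hyI⟩ := (h.tiles j).exists_mem (by simpa using h.tile_ne_nil j) hy
  obtain ⟨⟨i, k⟩, hp, rfl⟩ := List.mem_map.1 hI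
  obtain ⟨z, hz, rfl⟩ := exists_along_eq hyI
  have had := h.admissible i
  -- The return word is cut at the level containing the point: the first part climbs from the base
  -- to it, the second completes the return.
  rw [← List.take_append_drop k (w i), admissible_append] at had
  refine ⟨⟨E.branch v i z, hE.branch_mem hv hz, ?_⟩, i, D.along v ((w i).take k),
    abs_along_sub D v _, ⟨z, hz, rfl⟩, fun a ha => ⟨?_, had.1.reflTransGen hv ha⟩⟩
  · rw [h.branch_eq, ← List.take_append_drop k (w i), along_append]
    simp only [List.take_append_drop]
    exact had.2.reflTransGen hv (along_mem_real hz)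
  · exact mem_piece_of_formLE hv (h.level_mem j _ hp).1 (h.level_mem j _ hp).2
      (along_mem_real ha)

end Exchange

open Exchange

section Substitution

variable (D : Exchange) (v : Fin 4 → ℝ)

/-- The matrix `P` with real entries. -/
noncomputable abbrev realP : Matrix (Fin 4) (Fin 4) ℝ := P.map (fun a : ℤ => (a : ℝ))

theorem piece_subst (j : Fin 4) : D.subst.piece v j = D.piece (realP *ᵥ v) j := by
  simp [piece, Exchange.subst, ev_pull]

theorem whole_subst : D.subst.whole v = D.whole (realP *ᵥ v) := by
  simp [whole, Exchange.subst, ev_pull]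

theorem branch_subst (j : Fin 4) : D.subst.branch v j = D.branch (realP *ᵥ v) j := by
  funext x
  simp [branch, Exchange.subst, ev_pull]

theorem step_subst : D.subst.Step v = D.Step (realP *ᵥ v) := by
  funext x y
  simp only [Step, piece_subst, branch_subst]

theorem openRun_subst (n : ℕ) (x : ℝ) :
    D.subst.OpenRun v n x ↔ D.OpenRun (realP *ᵥ v) n x := by
  induction n generalizing x with
  | zero => exact Iff.rfl
  | succ n ih =>
    simp only [OpenRun, OpenStep, ih, branch_subst]
    simp [Exchange.subst, ev_pull]

end Substitution

/-- A sequence of positive length vectors, each the image of the next one by `P`, tending to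
zero. -/
structure IsScale (v : ℕ → Fin 4 → ℝ) : Prop where
  pos : ∀ n k, 0 < v n k
  eq : ∀ n, realP *ᵥ v (n + 1) = v n
  tendsto : Filter.Tendsto (fun n => ev ![1, 1, 1, 1] (v n)) Filter.atTop (nhds 0)

/-- A point whose orbit under `f` stays in the open intervals of `exT`. -/
def IsRegular (v : Fin 4 → ℝ) (f : ℝ → ℝ) (x : ℝ) : Prop :=
  ∀ k : ℕ, ∃ j, f^[k] x ∈ Ioo (ev (exT.left j) v) (ev (exT.right j) v)

/-- `f` coincides with the branches of `exT` on the open intervals. -/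
def Follows (v : Fin 4 → ℝ) (f : ℝ → ℝ) : Prop :=
  ∀ j, ∀ x ∈ Ioo (ev (exT.left j) v) (ev (exT.right j) v), f x = exT.branch v j x

theorem isRegular_of_openRun {v : Fin 4 → ℝ} {f : ℝ → ℝ} (hf : Follows v f) {x : ℝ}
    (hx : ∀ N, exT.OpenRun v N x) : IsRegular v f x := by
  intro k
  have := hx (k + 1)
  clear hx
  induction k generalizing x with
  | zero =>
    obtain ⟨y, ⟨j, hj, -⟩, -⟩ := this
    exact ⟨j, hj⟩
  | succ k ih =>
    obtain ⟨y, ⟨j, hj, rfl⟩, hy⟩ := this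
    rw [Function.iterate_succ_apply, hf j x hj]
    exact ih hy

namespace IsScale

variable {v : ℕ → Fin 4 → ℝ} (hv : IsScale v)
include hv

theorem reflTransGen_succ {n : ℕ} {x y : ℝ}
    (h : Relation.ReflTransGen (exS.Step (v (n + 1))) x y) :
    Relation.ReflTransGen (exS.Step (v n)) x y := by
  have := induces_exS.reflTransGen (hv.pos (n + 1)) h
  rwa [step_subst, hv.eq] at this

theorem reflTransGen_exT {n : ℕ} {x y : ℝ} (h : Relation.ReflTransGen (exS.Step (v n)) x y) :
    Relation.ReflTransGen (exT.Step (v 0)) x y := by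
  induction n with
  | zero => exact induces_exT.reflTransGen (hv.pos 0) h
  | succ n ih => exact ih (hv.reflTransGen_succ h)

theorem exists_tower_succ {n : ℕ} {j : Fin 4} {y : ℝ} (hy : y ∈ exS.piece (v n) j) :
    (∃ z ∈ exS.whole (v (n + 1)), Relation.ReflTransGen (exS.Step (v n)) y z) ∧
    ∃ i, ∃ g : ℝ → ℝ, (∀ a b, |g a - g b| = |a - b|) ∧
      (∃ z ∈ exS.piece (v (n + 1)) i, g z = y) ∧
      ∀ a ∈ exS.piece (v (n + 1)) i,
        g a ∈ exS.piece (v n) j ∧ Relation.ReflTransGen (exS.Step (v n)) a (g a) := by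
  have := induces_exS.exists_tower (hv.pos (n + 1)) isExchange_exS (j := j) (y := y)
  rw [step_subst, piece_subst, hv.eq] at this
  exact this hy

theorem exists_small {x : ℝ} (hx : x ∈ exT.whole (v 0)) (n : ℕ) :
    ∃ z ∈ exS.whole (v n), Relation.ReflTransGen (exT.Step (v 0)) x z := by
  induction n with
  | zero =>
    obtain ⟨j, hj⟩ := isExchange_exT.exists_mem_piece hx
    exact (induces_exT.exists_tower (hv.pos 0) isExchange_exS hj).1
  | succ n ih =>
    obtain ⟨z, hz, hxz⟩ := ih
    obtain ⟨j, hj⟩ := isExchange_exS.exists_mem_piece hz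
    obtain ⟨z', hz', hzz'⟩ := (hv.exists_tower_succ hj).1
    exact ⟨z', hz', hxz.trans (hv.reflTransGen_exT hzz')⟩

theorem exists_tower {y : ℝ} (hy : y ∈ exT.whole (v 0)) (n : ℕ) :
    ∃ i, ∃ g : ℝ → ℝ, (∀ a b, |g a - g b| = |a - b|) ∧ (∃ z ∈ exS.piece (v n) i, g z = y) ∧
      ∀ a ∈ exS.piece (v n) i, Relation.ReflTransGen (exT.Step (v 0)) a (g a) := by
  induction n with
  | zero =>
    obtain ⟨j, hj⟩ := isExchange_exT.exists_mem_piece hy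
    obtain ⟨i, g, hg, hz, h⟩ := (induces_exT.exists_tower (hv.pos 0) isExchange_exS hj).2
    exact ⟨i, g, hg, hz, fun a ha => (h a ha).2⟩
  | succ n ih =>
    obtain ⟨i, g, hg, ⟨z, hz, rfl⟩, hgt⟩ := ih
    obtain ⟨i', g', hg', ⟨z', hz', rfl⟩, hgt'⟩ := (hv.exists_tower_succ hz).2
    exact ⟨i', fun a => g (g' a), fun a b => (hg _ _).trans (hg' a b), ⟨z', hz', rfl⟩,
      fun a ha => (hv.reflTransGen_exT (hgt' a ha).2).trans (hgt _ (hgt' a ha).1)⟩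

/-- Each return word contains the letter `j`, so the orbit passes through interval `j` before it
returns. -/
theorem exists_visit {n : ℕ} {x : ℝ} (hx : x ∈ exS.whole (v (n + 1))) (j : Fin 4) :
    ∃ a ∈ exS.piece (v n) j, Relation.ReflTransGen (exS.Step (v n)) x a := by
  obtain ⟨i, hi⟩ := isExchange_exS.exists_mem_piece hx
  obtain ⟨w₁, w₂, hw⟩ := List.append_of_mem (mem_wordS i j)
  have had := induces_exS.admissible i
  rw [hw, admissible_append] at had
  have h1 := had.1.reflTransGen (hv.pos (n + 1)) hi
  have h2 := mem_piece_of_formLE (hv.pos (n + 1)) had.2.1 had.2.2.1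
    (along_mem_real (D := exS.subst) (w := w₁) hi)
  rw [step_subst, hv.eq] at h1
  rw [piece_subst, hv.eq] at h2
  exact ⟨_, h2, h1⟩

/-- A run from the copy at scale `n + 1` is also a run at scale `n`, and the path of
`pointPath_singular` prepends at least one step to it. -/
theorem openRun_singular (N n : ℕ) (c : Fin 3) : exS.OpenRun (v n) N (ev (singular c) (v n)) := by
  induction N generalizing n c with
  | zero => trivial
  | succ N ih =>
    have h1 := induces_exS.openRun (hv.pos (n + 1)) (ih (n + 1) c)
    have h2 := (pointPath_singular c).openRun (hv.pos (n + 1)) h1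
    rw [openRun_subst, hv.eq, ev_pull, hv.eq] at h2
    refine h2.mono (Nat.add_le_add_left ?_ N)
    clear * -
    revert c
    decide

theorem openRun_exT_singular (N : ℕ) (c : Fin 3) :
    exT.OpenRun (v 0) N (ev (singular c) (v 0)) :=
  induces_exT.openRun (hv.pos 0) (hv.openRun_singular N 0 c)

theorem openRun_exT_one (N : ℕ) : exT.OpenRun (v 0) N (ev ![1, 1, 1, 1] (v 0)) :=
  (pointPath_exT.openRun (hv.pos 0) (hv.openRun_exT_singular N 0)).mono (Nat.le_add_right _ _)

/-- Distinct closed intervals can meet only at endpoints, so along a regular orbit the multivalued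
relation leaves no choice. -/
theorem step {f : ℝ → ℝ} (hf : Follows (v 0) f) {x y : ℝ}
    (hx : IsRegular (v 0) f x) (h : Relation.ReflTransGen (exT.Step (v 0)) x y) :
    ∃ k : ℕ, y = f^[k] x := by
  induction h with
  | refl => exact ⟨0, rfl⟩
  | tail _ hst ih =>
    obtain ⟨k, rfl⟩ := ih
    obtain ⟨i, hi, rfl⟩ := hst
    obtain ⟨j, hj⟩ := hx k
    obtain rfl : i = j := by
      rcases lt_trichotomy i j with hij | hij | hij
      · exact absurd (hj.1.trans_le hi.2)
          (ev_le (hv.pos 0) (isExchange_exT.sorted i j hij)).not_gt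
      · exact hij
      · exact absurd (hi.1.trans_lt hj.2)
          (ev_le (hv.pos 0) (isExchange_exT.sorted j i hij)).not_gt
    exact ⟨k + 1, by rw [Function.iterate_succ_apply', hf i _ hj]⟩

/-- The target lies in a tower over a base interval shorter than ε. The orbit visits that base and
then climbs the tower isometrically. -/
theorem dense_orbit {f : ℝ → ℝ} (hf : Follows (v 0) f) {x : ℝ}
    (hx : IsRegular (v 0) f x) (hxd : x ∈ exT.whole (v 0)) :
    exT.whole (v 0) ⊆ closure (orbit f x) := by
  intro y hy
  rw [Metric.mem_closure_iff]
  intro ε hε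
  obtain ⟨n, hn⟩ := (hv.tendsto.eventually (gt_mem_nhds hε)).exists
  obtain ⟨i, g, hg, ⟨z, hz, rfl⟩, hgt⟩ := hv.exists_tower hy n
  obtain ⟨u, hu, hxu⟩ := hv.exists_small hxd (n + 1)
  obtain ⟨a, ha, hua⟩ := hv.exists_visit hu i
  obtain ⟨k, hk⟩ := hv.step hf hx
    ((hxu.trans (hv.reflTransGen_exT hua)).trans (hgt a ha))
  refine ⟨g a, ⟨k, hk⟩, ?_⟩
  rw [Real.dist_eq, hg]
  have hbound : ∀ a ∈ exS.piece (v n) i, a ∈ Icc 0 (ev ![1, 1, 1, 1] (v n)) := fun a ha => by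
    rw [← ev_zero (v n)]
    refine ⟨le_trans (ev_le (hv.pos n) ?_) ha.1, ha.2.trans (ev_le (hv.pos n) ?_)⟩ <;>
      clear * - <;> revert i <;> decide
  have h1 := hbound a ha
  have h2 := hbound z hz
  rw [abs_lt]
  constructor <;> linarith [h1.1, h1.2, h2.1, h2.2]

end IsScale
end FlipIET

/-! ### Equivariant functions and their increments -/

namespace FlipIET
namespace Exchange

/-- `F` is multiplied by the linear part and translated along each branch, like the distribution
function of an invariant measure. -/
def Equivariant (D : Exchange) (v : Fin 4 → ℝ) (F : ℝ → ℝ) : Prop :=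
  ∀ j, ∃ K, ∀ x ∈ D.piece v j, F (D.branch v j x) = (if D.flip j then -F x else F x) + K

/-- The increment of `F` along the `j`-th interval. -/
def increment (D : Exchange) (v : Fin 4 → ℝ) (F : ℝ → ℝ) (j : Fin 4) : ℝ :=
  F (ev (D.right j) v) - F (ev (D.left j) v)

variable {D E : Exchange} {v : Fin 4 → ℝ} {w : Fin 4 → List (Fin 4)}
  {tile : Fin 4 → List (Fin 4 × ℕ)} {F : ℝ → ℝ}

theorem Equivariant.along (hF : D.Equivariant v F) (hv : ∀ k, 0 < v k) {w : List (Fin 4)}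
    {I : (Fin 4 → ℤ) × (Fin 4 → ℤ)} (h : D.Admissible w I) :
    ∃ K, ∀ x ∈ real v I, F (D.along v w x) = (if (D.total w).1 then -F x else F x) + K := by
  induction w generalizing I with
  | nil => exact ⟨0, fun x _ => by simp [total]⟩
  | cons j w ih =>
    obtain ⟨K, hK⟩ := ih h.2.2
    obtain ⟨K', hK'⟩ := hF j
    refine ⟨if (D.total w).1 then K - K' else K + K', fun x hx => ?_⟩
    rw [along_cons, hK _ ((D.branch_mem_real v).2 hx),
      hK' x (mem_piece_of_formLE hv h.1 h.2.1 hx)]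
    rcases h₁ : (D.total w).1 <;> rcases h₂ : D.flip j <;> simp [total, h₁, h₂] <;> ring

theorem Induces.equivariant (h : D.Induces E w tile) (hv : ∀ k, 0 < v k)
    (hF : D.Equivariant v F) : E.Equivariant v F := by
  intro i
  obtain ⟨K, hK⟩ := hF.along hv (h.admissible i)
  refine ⟨K, fun x hx => ?_⟩
  rw [h.branch_eq, hK x hx, h.total_eq]

/-- A flip changes the sign of F and also exchanges the endpoints, so increments are preserved. -/
theorem Equivariant.level (hF : D.Equivariant v F) (hv : ∀ k, 0 < v k) {w : List (Fin 4)}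
    {I : (Fin 4 → ℤ) × (Fin 4 → ℤ)} (hI : FormLE I.1 I.2) (h : D.Admissible w I) :
    F (ev (D.level w I).2 v) - F (ev (D.level w I).1 v) = F (ev I.2 v) - F (ev I.1 v) := by
  induction w generalizing I with
  | nil => rfl
  | cons j w ih =>
    have hI' : FormLE (D.image j I).1 (D.image j I).2 := by
      intro k
      have := hI k
      unfold image
      split_ifs <;> simp <;> linarith
    rw [level_cons, ih hI' h.2.2]
    obtain ⟨K, hK⟩ := hF j
    have h1 := hK _ (mem_piece_of_formLE hv h.1 h.2.1 ⟨le_rfl, ev_le hv hI⟩)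
    have h2 := hK _ (mem_piece_of_formLE hv h.1 h.2.1 ⟨ev_le hv hI, le_rfl⟩)
    unfold image
    rcases hf : D.flip j <;> simp [branch, hf, ev_add, ev_sub] at h1 h2 ⊢ <;> rw [h1, h2] <;> ring

theorem Induces.increment_eq (h : D.Induces E w tile) (hv : ∀ k, 0 < v k) {o : List (Fin 4)}
    (hE : E.IsExchange o) (hF : D.Equivariant v F) (j : Fin 4) :
    D.increment v F j = ((tile j).map fun p => E.increment v F p.1).sum := by
  rw [increment, (h.tiles j).sum_eq F, List.map_map]
  congr 1
  refine List.map_congr_left fun p _ => ?_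
  have had := h.admissible p.1
  rw [← List.take_append_drop p.2 (w p.1), admissible_append] at had
  exact hF.level hv (hE.le p.1) had.1

/-- An equivariant function which vanishes at the endpoints has invariant absolute value. -/
theorem Equivariant.abs_eq (hF : D.Equivariant v F) (hv : ∀ k, 0 < v k) {o : List (Fin 4)}
    (hD : D.IsExchange o) (h0 : F 0 = 0) (hinc : ∀ j, D.increment v F j = 0) {x y : ℝ}
    (h : Relation.ReflTransGen (D.Step v) x y) : |F x| = |F y| := by
  induction h with
  | refl => rfl
  | tail _ hst ih =>
    obtain ⟨j, hj, rfl⟩ := hst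
    rw [ih]
    have hends : ∀ j, F (ev (D.left j) v) = 0 := by
      have := hD.tiles.eq_zero (v := v) (H := F) (by rwa [ev_zero]) (by
        simpa [increment, sub_eq_zero] using
          (⟨hinc 0, hinc 1, hinc 2, hinc 3⟩ : _ ∧ _ ∧ _ ∧ _))
      simpa [Fin.forall_fin_succ] using this
    have himg : ∀ j, F (ev (D.image j (D.left j, D.right j)).1 v) = 0 := by
      intro j
      refine hD.image_tiles.eq_zero (v := v) (H := F) (by rwa [ev_zero]) ?_ _
        (List.mem_map_of_mem (hD.mem_order j))
      intro I hI
      obtain ⟨i, -, rfl⟩ := List.mem_map.1 hI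
      have := hF.level hv (w := [i]) (I := (D.left i, D.right i)) (hD.le i)
        ⟨fun _ => le_rfl, fun _ => le_rfl, trivial⟩
      rw [← sub_eq_zero]
      exact this.trans (hinc i)
    obtain ⟨K, hK⟩ := hF j
    have hl := hends j
    have hr : F (ev (D.right j) v) = 0 := by simpa [increment, hl] using hinc j
    -- The branch sends an endpoint, where F vanishes, to an endpoint of the image, where F vanishes
    -- too.
    have hK0 : K = 0 := by
      have h1 := hK _ ⟨le_rfl, ev_le hv (hD.le j)⟩
      have h2 := hK _ ⟨ev_le hv (hD.le j), le_rfl⟩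
      have h3 := himg j
      unfold image at h3
      rcases hf : D.flip j <;> simp [branch, hf, ev_add, ev_sub] at h1 h2 h3 <;> linarith
    rw [hK _ hj, hK0]
    split_ifs <;> simp

end Exchange

open Exchange

theorem equivariant_subst {D : Exchange} {v : Fin 4 → ℝ} {F : ℝ → ℝ} :
    D.subst.Equivariant v F ↔ D.Equivariant (realP *ᵥ v) F := by
  simp only [Equivariant, piece_subst, branch_subst]
  rfl

theorem increment_subst {D : Exchange} {v : Fin 4 → ℝ} {F : ℝ → ℝ} :
    D.subst.increment v F = D.increment (realP *ᵥ v) F := by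
  funext j
  simp [increment, Exchange.subst, ev_pull]

end FlipIET

/-! ### Backward orbits of a positive matrix -/

namespace FlipIET

/-- A bounded backward orbit of a stochastic matrix with positive entries is constant. -/
theorem constant_of_stochastic {ι : Type*} [Fintype ι] {q : ι → ι → ℝ} {δ : ℝ} (hδ : 0 < δ)
    (hq : ∀ i j, δ ≤ q i j) (hsum : ∀ i, ∑ j, q i j = 1) {x : ℕ → ι → ℝ}
    (hx : ∀ n i, x n i = ∑ j, q i j * x (n + 1) j) (h0 : ∀ n i, 0 ≤ x n i) (a i : ι) :
    x 0 i = x 0 a := by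
  classical
  have hq0 : ∀ i j, 0 ≤ q i j := fun i j => hδ.le.trans (hq i j)
  have hδ1 : δ ≤ 1 := (hq a a).trans
    ((Finset.single_le_sum (fun j _ => hq0 a j) (Finset.mem_univ a)).trans_eq (hsum a))
  -- Minimum principle: an average of numbers exceeding `x 0 a` exceeds it as well.
  have hsmall : ∀ n, ∃ i, x n i ≤ x 0 a := by
    intro n
    induction n with
    | zero => exact ⟨a, le_rfl⟩
    | succ n ih =>
      by_contra! hcon
      obtain ⟨i, hi⟩ := ih
      refine hi.not_gt ?_
      calc x 0 a = ∑ j, q i j * x 0 a := by rw [← Finset.sum_mul, hsum, one_mul]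
        _ < ∑ j, q i j * x (n + 1) j :=
          Finset.sum_lt_sum_of_nonempty ⟨a, Finset.mem_univ a⟩ fun j _ =>
            mul_lt_mul_of_pos_left (hcon j) (hδ.trans_le (hq i j))
        _ = x n i := (hx n i).symm
  -- A small average of nonnegative numbers with weights at least δ bounds every one of them.
  have hbdd : ∀ n j, x (n + 1) j ≤ x 0 a / δ := by
    intro n j
    obtain ⟨i, hi⟩ := hsmall n
    rw [le_div_iff₀ hδ]
    calc x (n + 1) j * δ ≤ q i j * x (n + 1) j := by
          rw [mul_comm]; exact mul_le_mul_of_nonneg_right (hq i j) (h0 _ _)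
      _ ≤ ∑ j, q i j * x (n + 1) j :=
          Finset.single_le_sum (fun j _ => mul_nonneg (hq0 i j) (h0 _ j)) (Finset.mem_univ j)
      _ = x n i := (hx n i).symm
      _ ≤ x 0 a := hi
  -- Every average gives weight at least δ to coordinate `a`, so an enclosing interval shrinks by
  -- the factor 1 - δ at each step towards time 0.
  have hosc : ∀ (n : ℕ) (A B : ℝ), (∀ j, A ≤ x n j ∧ x n j ≤ B) → ∀ i k,
      x 0 i - x 0 k ≤ (1 - δ) ^ n * (B - A) := by
    intro n
    induction n with
    | zero => intro A B h i k; have := h i; have := h k; simp; linarith [(h i).2, (h k).1]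
    | succ n ih =>
      intro A B h i k
      have hlow : ∀ i, A + δ * (x (n + 1) a - A) ≤ x n i := by
        intro i
        have h1 : q i a * (x (n + 1) a - A) ≤ ∑ j, q i j * (x (n + 1) j - A) :=
          Finset.single_le_sum (f := fun j => q i j * (x (n + 1) j - A))
            (fun j _ => mul_nonneg (hq0 i j) (sub_nonneg.2 (h j).1)) (Finset.mem_univ a)
        simp only [mul_sub, Finset.sum_sub_distrib, ← Finset.sum_mul, hsum, ← hx] at h1
        have h2 := mul_le_mul_of_nonneg_right (hq i a) (sub_nonneg.2 (h a).1)
        linarith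
      have hupp : ∀ i, x n i ≤ B - δ * (B - x (n + 1) a) := by
        intro i
        have h1 : q i a * (B - x (n + 1) a) ≤ ∑ j, q i j * (B - x (n + 1) j) :=
          Finset.single_le_sum (f := fun j => q i j * (B - x (n + 1) j))
            (fun j _ => mul_nonneg (hq0 i j) (sub_nonneg.2 (h j).2)) (Finset.mem_univ a)
        simp only [mul_sub, Finset.sum_sub_distrib, ← Finset.sum_mul, hsum, ← hx] at h1
        have h2 := mul_le_mul_of_nonneg_right (hq i a) (sub_nonneg.2 (h a).2)
        linarith
      refine (ih _ _ (fun j => ⟨hlow j, hupp j⟩) i k).trans_eq ?_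
      ring
  have hlim : Filter.Tendsto (fun n : ℕ => (1 - δ) ^ (n + 1) * (x 0 a / δ - 0)) Filter.atTop
      (nhds 0) := by
    have := ((tendsto_pow_atTop_nhds_zero_of_lt_one (sub_nonneg.2 hδ1)
      (sub_lt_self 1 hδ)).comp (Filter.tendsto_add_atTop_nat 1)).mul_const (x 0 a / δ - 0)
    simpa using this
  have hle : ∀ i k, x 0 i ≤ x 0 k := fun i k => sub_nonpos.1 <|
    ge_of_tendsto' hlim fun n => hosc (n + 1) 0 _ (fun j => ⟨h0 _ j, hbdd n j⟩) i k
  exact le_antisymm (hle i a) (hle a i)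

/-- The length vector `η⁻ⁿ ν`. -/
noncomputable def scale (η : ℝ) (ν : Fin 4 → ℝ) (n : ℕ) : Fin 4 → ℝ := (η ^ n)⁻¹ • ν

theorem one_le_P (i j : Fin 4) : 1 ≤ P i j := by
  fin_cases i <;> fin_cases j <;> simp [P]

section Eigenvector

variable {η : ℝ} {ν : Fin 4 → ℝ} (hν : ∀ k, 0 < ν k) (hP : realP *ᵥ ν = η • ν)
include hν hP

theorem three_lt_eigenvalue : 3 < η := by
  have := congrFun hP 0
  simp [Matrix.mulVec, dotProduct, Fin.sum_univ_four, P] at this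
  nlinarith [hν 0, hν 1, hν 2, hν 3]

theorem isScale : IsScale (scale η ν) := by
  have hη := three_lt_eigenvalue hν hP
  refine ⟨fun n k => mul_pos (by positivity) (hν k), fun n => ?_, ?_⟩
  · rw [scale, Matrix.mulVec_smul, hP, smul_smul, scale, pow_succ]
    congr 1
    field_simp
  · have h := (tendsto_inv_atTop_zero.comp
      (tendsto_pow_atTop_atTop_of_one_lt (show 1 < η by linarith))).mul_const (ev ![1, 1, 1, 1] ν)
    rw [zero_mul] at h
    refine h.congr fun n => ?_
    simp [scale, ev]
    ring

/-- Conjugating P by the diagonal matrix of ν and dividing by η gives a stochastic matrix with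
positive entries. -/
theorem exists_smul_of_nonneg {m : ℕ → Fin 4 → ℝ} (hm : ∀ n, realP *ᵥ m (n + 1) = m n)
    (h0 : ∀ n i, 0 ≤ m n i) : ∃ c : ℝ, m 0 = c • ν := by
  have hη : 0 < η := by linarith [three_lt_eigenvalue hν hP]
  obtain ⟨δ, hδ, hle⟩ : ∃ δ : ℝ, 0 < δ ∧ ∀ i j, δ ≤ P i j * ν j / (η * ν i) := by
    obtain ⟨p, hp⟩ := Finite.exists_min fun p : Fin 4 × Fin 4 => P p.1 p.2 * ν p.2 / (η * ν p.1)
    refine ⟨_, ?_, fun i j => hp (i, j)⟩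
    have : (1 : ℝ) ≤ P p.1 p.2 := by exact_mod_cast one_le_P _ _
    exact div_pos (mul_pos (by linarith) (hν _)) (mul_pos hη (hν _))
  have key := constant_of_stochastic hδ hle (x := fun n i => m n i * η ^ n / ν i) ?_ ?_ ?_ 0
  · refine ⟨m 0 0 / ν 0, funext fun i => ?_⟩
    have := key i
    have h1 := (hν i).ne'
    have h2 := (hν 0).ne'
    simp only [pow_zero, mul_one] at this
    rw [Pi.smul_apply, smul_eq_mul, ← this]
    field_simp
  · intro i
    have := congrFun hP i
    simp only [Matrix.mulVec, dotProduct, Matrix.map_apply, Pi.smul_apply, smul_eq_mul] at this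
    rw [← Finset.sum_div, this, div_self (mul_pos hη (hν i)).ne']
  · intro n i
    have := congrFun (hm n) i
    simp only [Matrix.mulVec, dotProduct, Matrix.map_apply] at this
    simp only [← this]
    rw [Finset.sum_mul, Finset.sum_div]
    refine Finset.sum_congr rfl fun j _ => ?_
    have h1 := (hν i).ne'
    have h2 := (hν j).ne'
    rw [pow_succ]
    field_simp
  · intro n i
    exact div_nonneg (mul_nonneg (h0 n i) (by positivity)) (hν i).le

theorem exists_smul_scale {m : ℕ → Fin 4 → ℝ} (hm : ∀ n, realP *ᵥ m (n + 1) = m n)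
    (h0 : ∀ n i, 0 ≤ m n i) : ∃ c : ℝ, ∀ n, m n = c • scale η ν n := by
  have hη : 0 < η := by linarith [three_lt_eigenvalue hν hP]
  have hex : ∀ n, ∃ c : ℝ, m n = c • scale η ν n := fun n => by
    obtain ⟨c, hc⟩ := exists_smul_of_nonneg hν hP (m := fun k => m (k + n))
      (fun k => by have := hm (k + n); rwa [show k + 1 + n = k + n + 1 by ring])
      (fun k i => h0 _ i)
    refine ⟨c * η ^ n, ?_⟩
    simp only [zero_add] at hc
    rw [hc, scale, smul_smul]
    congr 1
    field_simp
  choose c hc using hex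
  have hsucc : ∀ n, c (n + 1) = c n := by
    intro n
    have h1 := hm n
    rw [hc (n + 1), Matrix.mulVec_smul, (isScale hν hP).eq, hc n] at h1
    exact mul_right_cancel₀ ((isScale hν hP).pos n 0).ne' (congrFun h1 0)
  refine ⟨c 0, fun n => ?_⟩
  rw [hc n]
  congr 1
  induction n with
  | zero => rfl
  | succ n ih => rw [hsucc, ih]

open Exchange

/-- The only monotone equivariant functions are the linear ones. -/
theorem linear_of_equivariant {F : ℝ → ℝ} (hF : exT.Equivariant ν F) (hF0 : F 0 = 0)
    (hmono : MonotoneOn F (exT.whole ν)) : ∃ c : ℝ, ∀ x ∈ exT.whole ν, F x = c * x := by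
  have hs := isScale hν hP
  have hs0 : scale η ν 0 = ν := by simp [scale]
  have hFS : ∀ n, exS.Equivariant (scale η ν n) F := by
    intro n
    induction n with
    | zero => exact induces_exT.equivariant (hs.pos 0) (by rwa [hs0])
    | succ n ih =>
      exact induces_exS.equivariant (hs.pos _) (by rwa [equivariant_subst, hs.eq])
  have hwhole : ∀ n, exS.whole (scale η ν n) ⊆ exT.whole ν := by
    intro n
    induction n with
    | zero =>
      rw [hs0]
      exact Icc_subset_Icc (ev_le hν (by decide)) (ev_le hν (by decide))
    | succ n ih =>
      refine Subset.trans ?_ ih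
      rw [← hs.eq n, ← whole_subst]
      exact Icc_subset_Icc (ev_le (hs.pos _) (by decide)) (ev_le (hs.pos _) (by decide))
  -- The increments satisfy the recursion of P by `tileS_count` and are nonnegative by monotonicity.
  obtain ⟨c, hc⟩ := exists_smul_scale hν hP (m := fun n => exS.increment (scale η ν n) F)
    (fun n => by
      funext j
      rw [← tileS_count, ← induces_exS.increment_eq (hs.pos _) isExchange_exS
        (by rw [equivariant_subst, hs.eq]; exact hFS n), increment_subst, hs.eq])
    (fun n i => by
      have hp := hs.pos n
      refine sub_nonneg.2 (hmono (hwhole n ⟨?_, ?_⟩) (hwhole n ⟨?_, ?_⟩)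
        (ev_le hp (isExchange_exS.le i))) <;>
      refine ev_le hp ?_ <;> clear * - <;> revert i <;> decide)
  set H : ℝ → ℝ := fun x => F x - c * x with hH
  have hHeq : ∀ {D : Exchange} {v : Fin 4 → ℝ}, D.Equivariant v F → D.Equivariant v H := by
    intro D v h j
    obtain ⟨K, hK⟩ := h j
    refine ⟨K - c * ev (D.shift j) v, fun x hx => ?_⟩
    simp only [hH, hK x hx]
    rcases hf : D.flip j <;> simp [branch, hf] <;> ring
  have hH0 : H 0 = 0 := by simp [hH, hF0]
  have hinc : ∀ n j, exS.increment (scale η ν n) H j = 0 := by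
    intro n j
    have h1 := congrFun (hc n) j
    have h2 : ev (exS.right j) (scale η ν n) - ev (exS.left j) (scale η ν n) = scale η ν n j := by
      fin_cases j <;> simp [exS, ev]
    simp only [increment, Pi.smul_apply, smul_eq_mul, hH] at h1 ⊢
    rw [← h2] at h1
    linarith
  have hincT : ∀ j, exT.increment ν H j = 0 := by
    intro j
    have := induces_exT.increment_eq (v := ν) hν isExchange_exS (hHeq hF) j
    rw [← hs0] at this ⊢
    rw [this]
    simp [hinc]
  refine ⟨c, fun x hx => ?_⟩
  -- The value is carried to a point of the small interval, where F z lies between 0 and c times the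
  -- total length and c * z is bounded likewise.
  have hbound : ∀ n, |H x| ≤ 2 * |c| * ev ![1, 1, 1, 1] (scale η ν n) := by
    intro n
    obtain ⟨z, hz, hxz⟩ := hs.exists_small (by rwa [hs0]) n
    rw [hs0] at hxz
    rw [(hHeq hF).abs_eq hν isExchange_exT hH0 hincT hxz]
    have hz' : 0 ≤ z ∧ z ≤ ev ![1, 1, 1, 1] (scale η ν n) := by
      have := hz
      rwa [whole, isExchange_exS.left_zero, ev_zero] at this
    have h00 : (0 : ℝ) ∈ exS.whole (scale η ν n) := by
      rw [whole, isExchange_exS.left_zero, ev_zero]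
      exact ⟨le_rfl, hz'.1.trans hz'.2⟩
    have htot : F (ev ![1, 1, 1, 1] (scale η ν n)) = c * ev ![1, 1, 1, 1] (scale η ν n) := by
      have := isExchange_exS.tiles.eq_zero (v := scale η ν n) (H := H) (by rwa [ev_zero])
        (by simpa [increment, sub_eq_zero] using
          (⟨hinc n 0, hinc n 1, hinc n 2, hinc n 3⟩ : _ ∧ _ ∧ _ ∧ _))
      have h3 : H (ev (exS.left 3) (scale η ν n)) = 0 := this (exS.left 3, exS.right 3) (by simp)
      have h4 := hinc n 3
      rw [increment, h3, sub_zero] at h4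
      exact sub_eq_zero.1 h4
    have hFz0 := hmono (hwhole n h00) (hwhole n hz) hz'.1
    have hFz1 := (hmono (hwhole n hz) (hwhole n ⟨hz.1.trans hz.2, le_rfl⟩) hz'.2).trans_eq htot
    rw [hF0] at hFz0
    have h1 : |c * z| ≤ |c| * ev ![1, 1, 1, 1] (scale η ν n) := by
      rw [abs_mul, abs_of_nonneg hz'.1]
      exact mul_le_mul_of_nonneg_left hz'.2 (abs_nonneg c)
    have h2 : |F z| ≤ |c| * ev ![1, 1, 1, 1] (scale η ν n) := by
      rw [abs_of_nonneg hFz0]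
      exact hFz1.trans (mul_le_mul_of_nonneg_right (le_abs_self c) (hz'.1.trans hz'.2))
    calc |H z| ≤ |F z| + |c * z| := abs_sub _ _
      _ ≤ _ := by linarith
  have hlim := hs.tendsto.const_mul (2 * |c|)
  rw [mul_zero] at hlim
  exact sub_eq_zero.1 (abs_nonpos_iff.1 (ge_of_tendsto' hlim hbound))

end Eigenvector
end FlipIET

/-! ### The Perron–Frobenius pair -/

namespace FlipIET

section PerronFrobenius

variable {η : ℝ} {ν : Fin 4 → ℝ} (hν : ∀ k, 0 < ν k) (hP : realP *ᵥ ν = η • ν)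
include hν hP

theorem isPerronFrobeniusEigenvalue_of_pos : IsPerronFrobeniusEigenvalue P η := by
  have hη : 0 < η := by linarith [three_lt_eigenvalue hν hP]
  refine ⟨Module.End.hasEigenvalue_of_hasEigenvector (x := fun i => (ν i : ℂ))
    ⟨Module.End.mem_eigenspace_iff.2 ?_, fun h => ?_⟩, fun z hz => ?_⟩
  · funext i
    have := congrArg (fun x : ℝ => (x : ℂ)) (congrFun hP i)
    simpa [Matrix.toLin'_apply, Matrix.mulVec, dotProduct] using this
  · have := congrFun h 0
    exact (hν 0).ne' (by simpa using this)
  · obtain ⟨w, hw⟩ := hz.exists_hasEigenvector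
    have hwz := hw.apply_eq_smul
    -- Row `i` of the eigenvalue equation, at the index maximizing the ratio to ν, yields the bound.
    obtain ⟨i, hi⟩ := Finite.exists_max fun i => ‖w i‖ / ν i
    have hle : ∀ j, ‖w j‖ ≤ ‖w i‖ / ν i * ν j := fun j => (div_le_iff₀ (hν j)).1 (hi j)
    have hwi : 0 < ‖w i‖ := by
      by_contra h
      have h0 : ‖w i‖ = 0 := le_antisymm (not_lt.1 h) (norm_nonneg _)
      refine hw.2 (funext fun j => ?_)
      have := hle j
      rw [h0, zero_div, zero_mul] at this
      exact norm_le_zero_iff.1 this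
    refine le_of_mul_le_mul_right ?_ hwi
    have h1 := congrFun hwz i
    have h2 := congrFun hP i
    simp only [Matrix.toLin'_apply, Matrix.mulVec, dotProduct, Matrix.map_apply, Pi.smul_apply,
      smul_eq_mul] at h1 h2
    calc ‖z‖ * ‖w i‖ = ‖∑ j, (P i j : ℂ) * w j‖ := by rw [h1, norm_mul]
      _ ≤ ∑ j, ‖(P i j : ℂ) * w j‖ := norm_sum_le _ _
      _ ≤ ∑ j, (P i j : ℝ) * ν j * (‖w i‖ / ν i) := by
        refine Finset.sum_le_sum fun j _ => ?_
        have hPij : (0 : ℝ) ≤ P i j := by exact_mod_cast zero_le_one.trans (one_le_P i j)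
        rw [norm_mul, Complex.norm_intCast, abs_of_nonneg hPij, mul_assoc, mul_comm (ν j)]
        exact mul_le_mul_of_nonneg_left (hle j) hPij
      _ = η * ‖w i‖ := by
        rw [← Finset.sum_mul, h2]
        have := (hν i).ne'
        field_simp

theorem eq_of_eigenvector {ν' : Fin 4 → ℝ} (hν' : ∀ k, 0 < ν' k) (hP' : realP *ᵥ ν' = η • ν')
    (h1 : ∑ i, ν i = 1) (h1' : ∑ i, ν' i = 1) : ν' = ν := by
  obtain ⟨c, hc⟩ := exists_smul_of_nonneg hν hP (isScale hν' hP').eq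
    (fun n i => ((isScale hν' hP').pos n i).le)
  have hc' : ν' = c • ν := by simpa [scale] using hc
  have : c = 1 := by
    rw [hc'] at h1'
    simpa [← Finset.mul_sum, h1] using h1'
  rw [hc', this, one_smul]

end PerronFrobenius

theorem existsUnique_isPerronFrobeniusPair :
    ∃! p : ℝ × (Fin 4 → ℝ), IsPerronFrobeniusPair P p.1 p.2 := by
  -- The characteristic polynomial of P is (x - 1)(x³ - 11x² + 7x - 1).
  obtain ⟨η, ⟨hη, -⟩, hroot⟩ : ∃ η ∈ Icc (10 : ℝ) 11, η ^ 3 - 11 * η ^ 2 + 7 * η - 1 = 0 :=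
    intermediate_value_Icc (by norm_num) (by fun_prop) ⟨by norm_num, by norm_num⟩
  set d := η ^ 2 - 4 * η + 1 with hd
  have hd0 : 0 < d := by nlinarith
  set s := 2 * d + (4 * η - 2) + 2 * η with hsdef
  have hs : 0 < s := by linarith
  -- The outer entries agree because (1, 0, 0, -1) is a left eigenvector for the eigenvalue 1.
  set ν : Fin 4 → ℝ := s⁻¹ • ![d, 4 * η - 2, 2 * η, d] with hνdef
  have hν : ∀ k, 0 < ν k := by
    intro k
    refine mul_pos (inv_pos.2 hs) ?_
    fin_cases k <;> simp <;> linarith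
  have hP : realP *ᵥ ν = η • ν := by
    rw [hνdef, Matrix.mulVec_smul, smul_comm]
    congr 1
    funext k
    fin_cases k <;> simp [Matrix.mulVec, dotProduct, Fin.sum_univ_four, P, hd] <;> linarith
  have hsum : ∑ i, ν i = 1 := by
    have : ∑ i, ν i = s⁻¹ * s := by
      simp [hνdef, Fin.sum_univ_four, hsdef]
      ring
    rw [this, inv_mul_cancel₀ hs.ne']
  refine ⟨(η, ν), ⟨isPerronFrobeniusEigenvalue_of_pos hν hP, hP, hν, hsum⟩, ?_⟩
  rintro ⟨η', ν'⟩ h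
  have h1 : η' ≤ η := by
    have := (isPerronFrobeniusEigenvalue_of_pos hν hP).2 _ h.eigenvalue.1
    exact (le_abs_self _).trans (by simpa using this)
  have h2 : η ≤ η' := by
    have := h.eigenvalue.2 _ (isPerronFrobeniusEigenvalue_of_pos hν hP).1
    exact (le_abs_self _).trans (by simpa using this)
  obtain rfl : η' = η := le_antisymm h1 h2
  exact congrArg _ (eq_of_eigenvector hν hP h.pos h.eigenvector hsum h.sum_eq_one)

/-! ### The map itself, in terms of ν -/

open Exchange

section Map

variable (ν : Fin 4 → ℝ)

theorem lengths_eq : lengths ν = ![ν 0, ν 1 + ν 2, ν 2 + ν 3, ν 1] := by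
  funext k
  fin_cases k <;> simp [lengths, Matrix.mulVec, dotProduct, Fin.sum_univ_four, Q]

theorem total_lengths : total (lengths ν) = ν 0 + 2 * ν 1 + 2 * ν 2 + ν 3 := by
  simp [total, lengths_eq]
  ring

theorem domain_eq : domain (lengths ν) = exT.whole ν := by
  simp [domain, whole, total_lengths, ev, exT]

theorem T_eq (x : ℝ) : T (lengths ν) x =
    if x < ν 0 then ν 0 + ν 2 + ν 3 - x
    else if x < ν 0 + ν 1 + ν 2 then 2 * ν 0 + 2 * ν 1 + 2 * ν 2 + ν 3 - x
    else if x < ν 0 + ν 1 + 2 * ν 2 + ν 3 then ν 0 + ν 1 + 2 * ν 2 + ν 3 - x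
    else 2 * ν 0 + 2 * ν 1 + 3 * ν 2 + 2 * ν 3 - x := by
  have h1 : ν 0 + (ν 1 + ν 2) = ν 0 + ν 1 + ν 2 := by ring
  have h2 : ν 0 + ν 1 + ν 2 + (ν 2 + ν 3) = ν 0 + ν 1 + 2 * ν 2 + ν 3 := by ring
  simp only [T, total_lengths]
  simp only [lengths_eq, Matrix.cons_val, h1, h2]
  split_ifs <;> ring

variable {ν} (hν : ∀ k, 0 < ν k)

theorem measurable_T : Measurable (T (lengths ν)) := by
  rw [show T (lengths ν) = _ from funext (T_eq ν)]
  refine Measurable.ite measurableSet_Iio (by fun_prop) ?_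
  refine Measurable.ite measurableSet_Iio (by fun_prop) ?_
  exact Measurable.ite measurableSet_Iio (by fun_prop) (by fun_prop)

include hν

theorem follows_T : Follows ν (T (lengths ν)) := by
  have h0 := hν 0; have h1 := hν 1; have h2 := hν 2; have h3 := hν 3
  rintro j x ⟨hl, hr⟩
  rw [T_eq]
  fin_cases j <;> simp [exT, ev, branch] at hl hr ⊢ <;> split_ifs <;>
    first | linarith | (intros; linarith)

theorem mapsTo_T : MapsTo (T (lengths ν)) (domain (lengths ν)) (domain (lengths ν)) := by
  have h0 := hν 0; have h1 := hν 1; have h2 := hν 2; have h3 := hν 3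
  rintro x ⟨hl, hr⟩
  rw [total_lengths] at hr
  simp only [domain, mem_Icc, total_lengths, T_eq]
  split_ifs <;> constructor <;> linarith

end Map

/-! ### Minimality -/

section Minimal

variable {η : ℝ} {ν : Fin 4 → ℝ} (hν : ∀ k, 0 < ν k) (hP : realP *ᵥ ν = η • ν)
include hν hP

theorem isRegular_singular (c : Fin 3) : IsRegular ν (T (lengths ν)) (ev (singular c) ν) := by
  have hs := isScale hν hP
  have hs0 : scale η ν 0 = ν := by simp [scale]
  exact isRegular_of_openRun (follows_T hν) fun N => by
    have := hs.openRun_exT_singular N c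
    rwa [hs0] at this

theorem isRegular_one : IsRegular ν (T (lengths ν)) (ev ![1, 1, 1, 1] ν) := by
  have hs := isScale hν hP
  have hs0 : scale η ν 0 = ν := by simp [scale]
  exact isRegular_of_openRun (follows_T hν) fun N => by
    have := hs.openRun_exT_one N
    rwa [hs0] at this

theorem exists_isRegular_iterate {x : ℝ} (hx : x ∈ domain (lengths ν)) :
    ∃ k : ℕ, IsRegular ν (T (lengths ν)) ((T (lengths ν))^[k] x) := by
  set f := T (lengths ν) with hf
  have h0 := hν 0; have h1 := hν 1; have h2 := hν 2; have h3 := hν 3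
  have hmaps : ∀ k : ℕ, f^[k] x ∈ domain (lengths ν) := fun k => (mapsTo_T hν).iterate k hx
  by_cases hreg : IsRegular ν f x
  · exact ⟨0, hreg⟩
  simp only [IsRegular, not_forall, not_exists] at hreg
  obtain ⟨k, hk⟩ := hreg
  set y := f^[k] x with hy
  have hyd := hmaps k
  rw [← hy, domain, total_lengths] at hyd
  have hk0 := hk 0; have hk1 := hk 1; have hk2 := hk 2; have hk3 := hk 3
  simp [exT, ev] at hk0 hk1 hk2 hk3
  have hcases : y = 0 ∨ y = ν 0 ∨ y = ν 0 + ν 1 + ν 2 ∨ y = ν 0 + ν 1 + 2 * ν 2 + ν 3 ∨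
      y = ν 0 + 2 * ν 1 + 2 * ν 2 + ν 3 := by
    by_contra! hne
    obtain ⟨g0, g1, g2, g3, g4⟩ := hne
    have a0 := lt_of_le_of_ne hyd.1 g0.symm
    have a1 := lt_of_le_of_ne (hk0 a0) g1.symm
    have a2 := lt_of_le_of_ne (hk1 a1) g2.symm
    have a3 := lt_of_le_of_ne (hk2 a2) g3.symm
    exact g4 (le_antisymm hyd.2 (hk3 a3))
  have hone : ∀ z, f y = z → IsRegular ν f z → ∃ k : ℕ, IsRegular ν f (f^[k] x) := by
    rintro z rfl hz
    exact ⟨k + 1, by rwa [Function.iterate_succ_apply']⟩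
  have hlast : f (ν 0 + 2 * ν 1 + 2 * ν 2 + ν 3) = ev (singular 2) ν := by
    rw [hf, T_eq]
    simp [singular, ev]
    split_ifs <;> linarith
  rcases hcases with h | h | h | h | h
  · refine hone _ ?_ (isRegular_singular hν hP 2)
    rw [h, hf, T_eq]
    simp [singular, ev, h0]
  -- This discontinuity is sent to the right end of the domain, hence the second step.
  · refine ⟨k + 2, ?_⟩
    rw [Function.iterate_succ_apply', Function.iterate_succ_apply', ← hy, h]
    have : f (ν 0) = ν 0 + 2 * ν 1 + 2 * ν 2 + ν 3 := by
      rw [hf, T_eq]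
      split_ifs <;> linarith
    rw [this, hlast]
    exact isRegular_singular hν hP 2
  · refine hone _ ?_ (isRegular_singular hν hP 1)
    rw [h, hf, T_eq]
    simp [singular, ev]
    split_ifs <;> linarith
  · refine hone _ ?_ (isRegular_one hν hP)
    rw [h, hf, T_eq]
    simp [ev]
    split_ifs <;> linarith
  · exact hone _ (by rw [h, hlast]) (isRegular_singular hν hP 2)

theorem isMinimalOn_T : IsMinimalOn (T (lengths ν)) (domain (lengths ν)) := by
  intro x hx
  obtain ⟨k, hk⟩ := exists_isRegular_iterate hν hP hx
  have hs := isScale hν hP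
  have hs0 : scale η ν 0 = ν := by simp [scale]
  have hd := (mapsTo_T hν).iterate k hx
  have := hs.dense_orbit (f := T (lengths ν)) (by rw [hs0]; exact follows_T hν)
    (by rwa [hs0]) (by rwa [hs0, ← domain_eq])
  rw [hs0, ← domain_eq] at this
  refine this.trans (closure_mono ?_)
  rintro _ ⟨m, rfl⟩
  exact ⟨m + k, by rw [Function.iterate_add_apply]⟩

end Minimal

/-! ### Invariant measures -/

section Ergodic

theorem restrict_Ioo_add {a b c : ℝ} (hab : a ≤ b) (hbc : b ≤ c) :
    (volume : Measure ℝ).restrict (Ioo a b) + volume.restrict (Ioo b c) =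
      volume.restrict (Ioo a c) := by
  simp only [Measure.restrict_congr_set Ioo_ae_eq_Ioc]
  rw [← Measure.restrict_union (Ioc_disjoint_Ioc_of_le le_rfl) measurableSet_Ioc,
    Ioc_union_Ioc_eq_Ioc hab hbc]

theorem map_reflection_restrict (t a b : ℝ) {f : ℝ → ℝ} (hf : ∀ x ∈ Ioo a b, f x = t - x) :
    (volume.restrict (Ioo a b)).map f = volume.restrict (Ioo (t - b) (t - a)) := by
  have h := ((Measure.measurePreserving_sub_left (volume : Measure ℝ) t).restrict_preimage
    (s := Ioo (t - b) (t - a)) measurableSet_Ioo).map_eq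
  rw [preimage_const_sub_Ioo, sub_sub_cancel, sub_sub_cancel] at h
  rw [← h]
  exact Measure.map_congr ((ae_restrict_iff' measurableSet_Ioo).2 (.of_forall hf))

variable {η : ℝ} {ν : Fin 4 → ℝ} (hν : ∀ k, 0 < ν k)

include hν in
theorem map_T_restrict : (volume.restrict (domain (lengths ν))).map (T (lengths ν)) =
    volume.restrict (domain (lengths ν)) := by
  have h0 := hν 0; have h1 := hν 1; have h2 := hν 2; have h3 := hν 3
  have hm : Measurable (T (lengths ν)) := measurable_T
  rw [domain, ← Measure.restrict_congr_set Ioo_ae_eq_Icc, total_lengths]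
  have hfol := follows_T hν
  have hb : ∀ j, ∀ x ∈ Ioo (ev (exT.left j) ν) (ev (exT.right j) ν),
      T (lengths ν) x = ev (exT.shift j) ν - x := by
    intro j x hx
    rw [hfol j x hx]
    fin_cases j <;> simp [branch, exT]
  have m0 := map_reflection_restrict _ _ _ (hb 0)
  have m1 := map_reflection_restrict _ _ _ (hb 1)
  have m2 := map_reflection_restrict _ _ _ (hb 2)
  have m3 := map_reflection_restrict _ _ _ (hb 3)
  simp [exT, ev] at m0 m1 m2 m3
  rw [show ν 0 + ν 2 + ν 3 - ν 0 = ν 2 + ν 3 by ring] at m0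
  rw [show 2 * ν 0 + 2 * ν 1 + 2 * ν 2 + ν 3 - (ν 0 + ν 1 + ν 2) = ν 0 + ν 1 + ν 2 + ν 3 by ring,
    show 2 * ν 0 + 2 * ν 1 + 2 * ν 2 + ν 3 - ν 0 = ν 0 + 2 * ν 1 + 2 * ν 2 + ν 3 by ring] at m1
  rw [show ν 0 + ν 1 + 2 * ν 2 + ν 3 - (ν 0 + ν 1 + ν 2) = ν 2 + ν 3 by ring] at m2
  rw [show 2 * ν 0 + 2 * ν 1 + 3 * ν 2 + 2 * ν 3 - (ν 0 + 2 * ν 1 + 2 * ν 2 + ν 3) =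
      ν 0 + ν 2 + ν 3 by ring,
    show 2 * ν 0 + 2 * ν 1 + 3 * ν 2 + 2 * ν 3 - (ν 0 + ν 1 + 2 * ν 2 + ν 3) =
      ν 0 + ν 1 + ν 2 + ν 3 by ring] at m3
  trans (volume.restrict (Ioo 0 (ν 0)) + (volume.restrict (Ioo (ν 0) (ν 0 + ν 1 + ν 2)) +
      (volume.restrict (Ioo (ν 0 + ν 1 + ν 2) (ν 0 + ν 1 + 2 * ν 2 + ν 3)) +
      volume.restrict (Ioo (ν 0 + ν 1 + 2 * ν 2 + ν 3) (ν 0 + 2 * ν 1 + 2 * ν 2 + ν 3))))).map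
      (T (lengths ν))
  · rw [restrict_Ioo_add, restrict_Ioo_add, restrict_Ioo_add] <;> linarith
  · simp only [Measure.map_add _ _ hm, m0, m1, m2, m3]
    have hc : ∀ a b, a ≤ b → b ≤ ν 0 + 2 * ν 1 + 2 * ν 2 + ν 3 →
        (volume : Measure ℝ).restrict (Ioo a (ν 0 + 2 * ν 1 + 2 * ν 2 + ν 3)) =
          volume.restrict (Ioo a b) +
            volume.restrict (Ioo b (ν 0 + 2 * ν 1 + 2 * ν 2 + ν 3)) :=
      fun a b h h' => (restrict_Ioo_add h h').symm
    -- The cut points separate the images of the four intervals, which lie in the order 2, 0, 3, 1.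
    rw [hc 0 (ν 2 + ν 3) (by linarith) (by linarith),
      hc (ν 2 + ν 3) (ν 0 + ν 2 + ν 3) (by linarith) (by linarith),
      hc (ν 0 + ν 2 + ν 3) (ν 0 + ν 1 + ν 2 + ν 3) (by linarith) (by linarith)]
    abel

/-- The measures which occur in the definition of unique ergodicity. -/
structure IsInvariantProbability (f : ℝ → ℝ) (s : Set ℝ) (μ : Measure ℝ) : Prop where
  isProbabilityMeasure : IsProbabilityMeasure μ
  compl : μ sᶜ = 0
  preserving : MeasurePreserving f μ μ

/-- Mass cannot decrease along an orbit, since the preimage of f y contains y; orbits are infinite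
by minimality, so an atom would give infinite mass. -/
theorem IsInvariantProbability.noAtoms {f : ℝ → ℝ} {s : Set ℝ} {μ : Measure ℝ}
    (h : IsInvariantProbability f s μ) (hmin : IsMinimalOn f s) (hs : s.Infinite) :
    NullSingletonClass μ := by
  have := h.isProbabilityMeasure
  refine ⟨fun x => ?_⟩
  by_contra hx
  have hxs : x ∈ s := by
    by_contra hxs
    exact hx (measure_mono_null (by simpa using hxs) h.compl)
  have hle : ∀ k : ℕ, μ {x} ≤ μ {f^[k] x} := by
    intro k
    induction k with
    | zero => exact le_rfl
    | succ k ih =>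
      refine ih.trans ?_
      rw [← h.preserving.measure_preimage (measurableSet_singleton (f^[k + 1] x)).nullMeasurableSet]
      exact measure_mono (by simp [Function.iterate_succ_apply'])
  have hinf : (orbit f x).Infinite := fun hfin =>
    hs (hfin.subset ((hmin x hxs).trans hfin.isClosed.closure_subset))
  have := hinf.meas_eq_top (μ := μ) ⟨μ {x}, hx, by rintro _ ⟨k, rfl⟩; exact hle k⟩
  exact measure_ne_top μ _ this

theorem measureReal_Ioo_eq {μ : Measure ℝ} [IsFiniteMeasure μ] [NullSingletonClass μ] {a b : ℝ}
    (hab : a ≤ b) : μ.real (Ioo a b) = μ.real (Iic b) - μ.real (Iic a) := by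
  rw [measureReal_congr Ioo_ae_eq_Ioc, show Ioc a b = Iic b \ Iic a by ext; simp [and_comm],
    measureReal_sdiff (Iic_subset_Iic.2 hab) measurableSet_Iic]

include hν in
theorem equivariant_of_invariant {μ : Measure ℝ}
    (h : IsInvariantProbability (T (lengths ν)) (domain (lengths ν)) μ) [NullSingletonClass μ] :
    exT.Equivariant ν fun x => μ.real (Iic x) := by
  have := h.isProbabilityMeasure
  have h0 := hν 0; have h1 := hν 1; have h2 := hν 2; have h3 := hν 3
  intro j
  set a := ev (exT.left j) ν with ha
  set t := ev (exT.shift j) ν with ht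
  have hb : ∀ x, exT.branch ν j x = t - x := by
    intro x
    fin_cases j <;> simp [branch, exT, ht]
  have hflip : exT.flip j = true := by fin_cases j <;> rfl
  refine ⟨μ.real (Iic (t - a)) + μ.real (Iic a), fun x hx => ?_⟩
  have hax : a ≤ x := hx.1
  -- Within the domain, the preimage of the reflected open interval is exactly the original one: the
  -- other pieces have images disjoint from it.
  have hpre : μ.real (Ioo (t - x) (t - a)) = μ.real (Ioo a x) := by
    rw [measureReal_def, measureReal_def,
      ← h.preserving.measure_preimage measurableSet_Ioo.nullMeasurableSet]
    congr 1
    refine measure_congr ?_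
    have hdom : ∀ᵐ y ∂μ, y ∈ domain (lengths ν) := h.compl
    filter_upwards [hdom] with y hy
    have hr := hx.2
    rw [domain, total_lengths] at hy
    obtain ⟨hy0, hy1⟩ := hy
    refine propext (?_ : T (lengths ν) y ∈ Ioo (t - x) (t - a) ↔ y ∈ Ioo a x)
    rw [T_eq, mem_Ioo, mem_Ioo]
    fin_cases j <;> simp [exT, ev] at ha ht hr <;> rw [ha, ht] at * <;> split_ifs <;>
      constructor <;> rintro ⟨h4, h5⟩ <;> constructor <;> linarith
  rw [measureReal_Ioo_eq (by linarith), measureReal_Ioo_eq hax] at hpre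
  simp only [hb, hflip, if_true]
  linarith

variable (hP : realP *ᵥ ν = η • ν)
include hν hP

theorem eq_of_invariant {μ : Measure ℝ}
    (h : IsInvariantProbability (T (lengths ν)) (domain (lengths ν)) μ) (x : ℝ) :
    μ.real (Iic x) = max 0 (min 1 (x / total (lengths ν))) := by
  have := h.isProbabilityMeasure
  have hL : 0 < total (lengths ν) := by
    rw [total_lengths]; linarith [hν 0, hν 1, hν 2, hν 3]
  have := h.noAtoms (isMinimalOn_T hν hP) (Icc_infinite hL)
  have hzero : ∀ x ≤ 0, μ.real (Iic x) = 0 := by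
    intro x hx
    rw [measureReal_congr Iio_ae_eq_Iic.symm, measureReal_def,
      measure_mono_null (fun y hy hyd => ?_) h.compl, ENNReal.toReal_zero]
    exact (hyd.1.trans_lt hy).not_ge hx
  have hone : ∀ x, total (lengths ν) ≤ x → μ.real (Iic x) = 1 := by
    intro x hx
    have : μ.real (Iic x)ᶜ = 0 := by
      rw [measureReal_def, measure_mono_null (fun y hy hyd => ?_) h.compl, ENNReal.toReal_zero]
      exact hy (hyd.2.trans hx)
    rw [measureReal_compl measurableSet_Iic, probReal_univ] at this
    linarith
  obtain ⟨c, hc⟩ := linear_of_equivariant hν hP (equivariant_of_invariant hν h) (hzero 0 le_rfl)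
    (fun a _ b _ hab => measureReal_mono (Iic_subset_Iic.2 hab))
  rw [← domain_eq] at hc
  have hcL := hc _ ⟨hL.le, le_rfl⟩
  rw [hone _ le_rfl] at hcL
  rcases le_or_gt x 0 with hx | hx
  · rw [hzero x hx, max_eq_left]
    exact (min_le_right _ _).trans (div_nonpos_of_nonpos_of_nonneg hx hL.le)
  rcases le_or_gt (total (lengths ν)) x with hx' | hx'
  · rw [hone x hx', min_eq_left ((one_le_div hL).2 hx'), max_eq_right zero_le_one]
  · rw [min_eq_right ((div_le_one hL).2 hx'.le), max_eq_right (div_nonneg hx.le hL.le),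
      hc x ⟨hx.le, hx'.le⟩, eq_div_iff hL.ne', mul_right_comm, ← hcL, one_mul]

omit hP in
theorem isInvariantProbability_normalizedLebesgue :
    IsInvariantProbability (T (lengths ν)) (domain (lengths ν))
      (normalizedLebesgue (domain (lengths ν))) := by
  have hL : 0 < total (lengths ν) := by
    rw [total_lengths]; linarith [hν 0, hν 1, hν 2, hν 3]
  have hvol : volume (domain (lengths ν)) = ENNReal.ofReal (total (lengths ν)) := by
    rw [domain, Real.volume_Icc, sub_zero]
  refine ⟨⟨?_⟩, ?_, measurable_T, ?_⟩
  · rw [normalizedLebesgue, Measure.smul_apply, Measure.restrict_apply_univ, smul_eq_mul]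
    exact ENNReal.inv_mul_cancel (by simpa [hvol] using hL) (by simp [hvol])
  · rw [normalizedLebesgue, Measure.smul_apply,
      Measure.restrict_apply (by exact measurableSet_Icc.compl), compl_inter_self]
    simp
  · rw [normalizedLebesgue, Measure.map_smul, map_T_restrict hν]

theorem isUniquelyErgodicOn_T : IsUniquelyErgodicOn (T (lengths ν)) (domain (lengths ν)) := by
  have hleb := isInvariantProbability_normalizedLebesgue hν
  intro μ
  constructor
  · rintro ⟨h1, h2, h3⟩
    have hμ : IsInvariantProbability (T (lengths ν)) (domain (lengths ν)) μ := ⟨h1, h2, h3⟩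
    have := hleb.isProbabilityMeasure
    refine Measure.ext_of_Iic _ _ fun x => ?_
    rw [← measureReal_eq_measureReal_iff]
    -- The formula does not involve the measure, so it is applied to Lebesgue measure as well.
    rw [eq_of_invariant hν hP hμ, eq_of_invariant hν hP hleb]
  · rintro rfl
    exact ⟨hleb.1, hleb.2, hleb.3⟩

end Ergodic
end FlipIET

theorem theorem1 :
    (∃! p : ℝ × (Fin 4 → ℝ), FlipIET.IsPerronFrobeniusPair FlipIET.P p.1 p.2) ∧
    ∀ (η : ℝ) (ν : Fin 4 → ℝ), FlipIET.IsPerronFrobeniusPair FlipIET.P η ν →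
      MapsTo (FlipIET.T (FlipIET.lengths ν)) (FlipIET.domain (FlipIET.lengths ν))
        (FlipIET.domain (FlipIET.lengths ν)) ∧
      FlipIET.IsMinimalOn (FlipIET.T (FlipIET.lengths ν))
        (FlipIET.domain (FlipIET.lengths ν)) ∧
      FlipIET.IsUniquelyErgodicOn (FlipIET.T (FlipIET.lengths ν))
        (FlipIET.domain (FlipIET.lengths ν)) :=
  ⟨FlipIET.existsUnique_isPerronFrobeniusPair, fun _ _ h =>
    ⟨FlipIET.mapsTo_T h.pos, FlipIET.isMinimalOn_T h.pos h.eigenvector,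
      FlipIET.isUniquelyErgodicOn_T h.pos h.eigenvector⟩⟩
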